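/- Let $n\ge 1$ and $1<p<\infty$, and let $p'=p/(p-1)$. Write $\mathbb{R}^{n+1}_+=\{(x,t): x\in\mathbb{R}^n,\ t\ge 0\}$. Cubes are axis-parallel half-open cubes $Q\subset\mathbb{R}^n$ with side length $\ell(Q)>0$, and $\tilde Q=\{(x,t): x\in Q,\ 0\le t<\ell(Q)\}$. A weight is a nonnegative locally integrable function $\sigma$ on $\mathbb{R}^n$, and $\sigma(Q)=\int_Q\sigma\,dx$. Let $$\mathcal M g(x,t)=\sup_{Q\ni x,\ \ell(Q)\ge t}\frac1{|Q|}\int_Q|g(y)|\,dy,\qquad (x,t)\in\mathbb{R}^{n+1}_+ .$$ A Young function is a continuous, strictly increasing, convex function $\Phi:[0,\infty)\to[0,\infty)$ with $\Phi(0)=0$ and $\Phi(t)\to\infty$ as $t\to\infty$. A complementary function of $\Phi$ is a convex, lower semicontinuous function $\bar\Phi:[0,\infty)\to[0,\infty]$ with $\bar\Phi(0)=0$ and $\bar\Phi(t)\to\infty$ as $t\to\infty$, such that $t\le\Phi^{-1}(t)\,\bar\Phi^{-1}(t)\le 2t$ for all $t\ge0$, where $\Psi^{-1}(t)=\sup\{s\ge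 0:\Psi(s)\le t\}$ for $\Psi\in\{\Phi,\bar\Phi\}$. For $\Psi\in\{\Phi,\bar\Phi\}$ let $$\|f\|_{\Psi,Q}=\inf\Big\{\lambda>0:\frac1{|Q|}\int_Q\Psi\Big(\frac{|f(x)|}{\lambda}\Big)dx\le1\Big\}\quad(\inf\emptyset=\infty),\qquad M_\Psi f(x)=\sup_{Q\ni x}\|f\|_{\Psi,Q}.$$ For a positive Borel measure $\mu$ on $\mathbb{R}^{n+1}_+$ and a weight $\sigma$ put, with all suprema over all cubes, $$[\mu,\sigma,\Phi]_{A'_p}=\sup_Q\frac{\mu(\tilde Q)}{|Q|}\big\|\sigma^{1/p'}\big\|_{\Phi,Q}^p,\qquad [\sigma,\bar\Phi]_{W_p}=\sup_Q\frac1{\sigma(Q)}\int_Q M_{\bar\Phi}\big(\sigma^{1/p}\chi_Q\big)^p\,dx,$$ where the conventions $0\cdot\infty=0$ and $0/0=0$ are used. **Theorem.** There is a finite constant $C$, depending only on $n$ and $p$, such that for every positive Borel measure $\mu$ on $\mathbb{R}^{n+1}_+$, every weight $\sigma$ on $\mathbb{R}^n$, every Young function $\Phi$ and every complementary function $\bar\Phi$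 of $\Phi$, $$\big\|\mathcal M(\cdot\,\sigma)\big\|_{L^p(\mathbb{R}^n,\sigma)\to L^p(\mathbb{R}^{n+1}_+,\mu)}\le C\,\big([\mu,\sigma,\Phi]_{A'_p}\,[\sigma,\bar\Phi]_{W_p}\big)^{1/p},$$ where the left side is the infimum of the $K\in[0,\infty]$ such that $\|\mathcal M(f\sigma)\|_{L^p(\mu)}\le K\,\|f\|_{L^p(\sigma)}$ for all $f\in L^p(\sigma)$. -/

import Mathlib

open MeasureTheory Filter Topology
open scoped NNReal ENNReal

noncomputable section

namespace Carleson

/-- An axis-parallel cube of `ℝⁿ` with positive side length, given by its lower corner. -/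
structure Cube (n : ℕ) where
  corner : Fin n → ℝ
  side : ℝ≥0
  side_pos : 0 < side

/-- The (half-open) set of points of a cube, as for the cubes of a dyadic grid. -/
def Cube.set {n : ℕ} (Q : Cube n) : Set (Fin n → ℝ) :=
  Set.univ.pi fun i => Set.Ico (Q.corner i) (Q.corner i + Q.side)

/-- The upper half-space `ℝ₊ⁿ⁺¹ = {(x, t) : x ∈ ℝⁿ, t ≥ 0}`. -/
abbrev HalfSpace (n : ℕ) : Type := (Fin n → ℝ) × ℝ≥0

/-- The cube `Q̃ = {(x, t) : x ∈ Q, 0 ≤ t < ℓ(Q)}` over `Q`. -/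
def Cube.tent {n : ℕ} (Q : Cube n) : Set (HalfSpace n) :=
  {z | z.1 ∈ Q.set ∧ z.2 < Q.side}

/-- The maximal operator `𝓜 g(x, t) = sup {|Q|⁻¹ ∫_Q |g| : x ∈ Q, ℓ(Q) ≥ t}`. -/
def maximal {n : ℕ} (g : (Fin n → ℝ) → ℝ) (z : HalfSpace n) : ℝ≥0∞ :=
  ⨆ (Q : Cube n) (_ : z.1 ∈ Q.set) (_ : z.2 ≤ Q.side), (∫⁻ y in Q.set, ‖g y‖ₑ) / volume Q.set

/-- A weight on `ℝⁿ`: a nonnegative locally integrable function. -/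
structure IsWeight {n : ℕ} (σ : (Fin n → ℝ) → ℝ) : Prop where
  nonneg : ∀ x, 0 ≤ σ x
  locallyIntegrable : LocallyIntegrable σ volume

/-- The measure `σ(x) dx`. -/
def weightMeasure {n : ℕ} (σ : (Fin n → ℝ) → ℝ) : Measure (Fin n → ℝ) :=
  volume.withDensity fun x => ENNReal.ofReal (σ x)

/-- The norm of `f ↦ 𝓜(f σ)` from `L^p(ℝⁿ, σ)` to `L^p(ℝ₊ⁿ⁺¹, μ)`, that is, the infimum of the
`K ∈ [0, ∞]` such that `‖𝓜(f σ)‖_{L^p(μ)} ≤ K ‖f‖_{L^p(σ)}` for all `f ∈ L^p(σ)`. -/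
def maximalNorm {n : ℕ} (p : ℝ) (μ : Measure (HalfSpace n)) (σ : (Fin n → ℝ) → ℝ) : ℝ≥0∞ :=
  sInf {K : ℝ≥0∞ | ∀ f : (Fin n → ℝ) → ℝ, MemLp f (ENNReal.ofReal p) (weightMeasure σ) →
    eLpNorm (maximal fun x => f x * σ x) (ENNReal.ofReal p) μ ≤
      K * eLpNorm f (ENNReal.ofReal p) (weightMeasure σ)}

/-- Young functions: continuous, strictly increasing, convex functions `[0, ∞) → [0, ∞)` that
vanish at `0` and tend to `∞`. -/
structure IsYoung (Φ : ℝ≥0 → ℝ≥0) : Prop where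
  continuous : Continuous Φ
  strictMono : StrictMono Φ
  convex : ConvexOn ℝ≥0 Set.univ Φ
  map_zero : Φ 0 = 0
  tendsto : Tendsto Φ atTop atTop

/-- Young functions in the extended sense: they may vanish on an initial interval and take the
value `∞`, as the complementary function of a Young function in general does
(`Φ(t) = t` has `Φ̄ = 0` on `[0, 1]` and `Φ̄ = ∞` on `(1, ∞)`). -/
structure IsExtYoung (Ψ : ℝ≥0 → ℝ≥0∞) : Prop where
  lowerSemicontinuous : LowerSemicontinuous Ψ
  convex : ConvexOn ℝ≥0 Set.univ Ψ
  map_zero : Ψ 0 = 0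
  tendsto : Tendsto Ψ atTop (𝓝 ∞)

/-- The inverse `Ψ⁻¹(t) = sup {s : Ψ(s) ≤ t}`; this is the usual inverse if `Ψ` is a bijection of
`[0, ∞)`. -/
def youngInv (Ψ : ℝ≥0 → ℝ≥0∞) (t : ℝ≥0) : ℝ≥0∞ :=
  ⨆ (s : ℝ≥0) (_ : Ψ s ≤ t), (s : ℝ≥0∞)

/-- `Ψ` is a complementary function of the Young function `Φ`: a Young function, in the extended
sense, with `t ≤ Φ⁻¹(t) Ψ⁻¹(t) ≤ 2 t` for all `t ≥ 0`. -/
structure IsComplementary (Φ : ℝ≥0 → ℝ≥0) (Ψ : ℝ≥0 → ℝ≥0∞) : Prop where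
  isExtYoung : IsExtYoung Ψ
  le_mul : ∀ t : ℝ≥0, (t : ℝ≥0∞) ≤ youngInv (fun s => (Φ s : ℝ≥0∞)) t * youngInv Ψ t
  mul_le : ∀ t : ℝ≥0, youngInv (fun s => (Φ s : ℝ≥0∞)) t * youngInv Ψ t ≤ 2 * t

/-- The localized Luxemburg norm
`‖f‖_{Ψ, Q} = inf {r > 0 : |Q|⁻¹ ∫_Q Ψ(|f(x)| / r) dx ≤ 1}`, with `inf ∅ = ∞`. -/
def luxNorm {n : ℕ} (Ψ : ℝ≥0 → ℝ≥0∞) (Q : Cube n) (f : (Fin n → ℝ) → ℝ) : ℝ≥0∞ :=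
  ⨅ (r : ℝ≥0) (_ : 0 < r) (_ : (∫⁻ x in Q.set, Ψ (‖f x‖₊ / r)) / volume Q.set ≤ 1), (r : ℝ≥0∞)

/-- The Orlicz maximal function `M_Ψ f(x) = sup {‖f‖_{Ψ, Q} : x ∈ Q}`. -/
def orliczMaximal {n : ℕ} (Ψ : ℝ≥0 → ℝ≥0∞) (f : (Fin n → ℝ) → ℝ) (x : Fin n → ℝ) : ℝ≥0∞ :=
  ⨆ (Q : Cube n) (_ : x ∈ Q.set), luxNorm Ψ Q f

/-- The constant `[μ, σ, Φ]_{A'_p} = sup_Q (μ(Q̃) / |Q|) ‖σ^{1/p'}‖_{Φ, Q}^p`. -/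
def bumpConst {n : ℕ} (p : ℝ) (μ : Measure (HalfSpace n)) (σ : (Fin n → ℝ) → ℝ)
    (Φ : ℝ≥0 → ℝ≥0) : ℝ≥0∞ :=
  ⨆ Q : Cube n, μ Q.tent / volume Q.set *
    luxNorm (fun s => (Φ s : ℝ≥0∞)) Q (fun x => σ x ^ (1 / Real.conjExponent p)) ^ p

/-- The constant `[σ, Ψ]_{W_p} = sup_Q σ(Q)⁻¹ ∫_Q M_Ψ(σ^{1/p} χ_Q)^p dx`. A cube with `σ(Q) = 0`
contributes `0`, since then both the integral and, by convention, the quotient `0 / 0` are `0`. -/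
def wilsonConst {n : ℕ} (p : ℝ) (σ : (Fin n → ℝ) → ℝ) (Ψ : ℝ≥0 → ℝ≥0∞) : ℝ≥0∞ :=
  ⨆ Q : Cube n,
    (∫⁻ x in Q.set, orliczMaximal Ψ (Q.set.indicator fun y => σ y ^ (1 / p)) x ^ p) /
      weightMeasure σ Q.set

end Carleson

end

/-! The operator is first reduced to dyadic ones. By the one-third trick every cube lies in a cube
of one of `2 ^ n` shifted dyadic grids, with side at most six times as large, so `maximal` is at
most `6 ^ n` times the largest of the `2 ^ n` maximal operators `dyadicMaximal`. Monotone
convergence then reduces each of these to finite families of grid cubes, which are laminar: any two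
members are disjoint or nested.

For a finite laminar family, `Laminar.exists_sparse` selects stopping cubes `S` whose averages
dominate all others up to a factor 2. Hence the `p`-th power of the maximal function is at most a
sum over `S` of terms `(2 · average) ^ p` supported on tents. Write the average of `|f| σ` over `Q`
as the `σ`-average `a_Q` of `|f|` times `σ(Q) / |Q|`. Hölder's inequality for Luxemburg norms,
applied to `σ = σ^{1/p'} σ^{1/p}`, bounds `σ(Q) / |Q|` by four times the product of the `Φ`- and
`Ψ`-norms. The `Φ`-norm together with `μ(Q̃) / |Q|` is absorbed by `bumpConst`, and what remains is
the sum of `c_Q a_Q^p` with `c_Q = |Q| ‖σ^{1/p}‖_{Ψ,Q}^p`.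

Sparseness and `wilsonConst` show that `c` is a Carleson sequence for `σ`: inside a selected cube
`R`, the sum of the `c_Q` is at most four times the integral over `R` of `M_Ψ(σ^{1/p} χ_R)^p`. The
embedding theorem `Laminar.carleson_embedding` finishes the proof. All constants depend on `n` and
`p` only. -/

noncomputable section

namespace Carleson

/-! ### Laminar families -/

/-- A finite family of sets any two distinct members of which are disjoint or nested, with a rank
that increases strictly along inclusions. -/
def Laminar {ι X : Type*} (F : Finset ι) (Q : ι → Set X) (r : ι → ℝ≥0) : Prop :=
  ∀ i ∈ F, ∀ j ∈ F, i ≠ j →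
    Disjoint (Q i) (Q j) ∨ (Q i ⊆ Q j ∧ r i < r j) ∨ (Q j ⊆ Q i ∧ r j < r i)

theorem Laminar.mono {ι X : Type*} {F G : Finset ι} {Q : ι → Set X} {r : ι → ℝ≥0}
    (h : Laminar F Q r) (hG : G ⊆ F) : Laminar G Q r :=
  fun i hi j hj => h i (hG hi) j (hG hj)

/-- The maximal members of a laminar family are disjoint and cover the family. -/
theorem Laminar.exists_maximal {ι X : Type*} {F : Finset ι} {Q : ι → Set X} {r : ι → ℝ≥0}
    (h : Laminar F Q r) :
    ∃ G ⊆ F, (G : Set ι).PairwiseDisjoint Q ∧ ∀ i ∈ F, ∃ j ∈ G, Q i ⊆ Q j := by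
  classical
  refine ⟨F.filter fun i => ∀ j ∈ F, Q i ⊆ Q j → ¬ r i < r j, Finset.filter_subset _ _, ?_, ?_⟩
  · intro i hi j hj hij
    simp only [Finset.coe_filter, Set.mem_ofPred_eq] at hi hj
    rcases h i hi.1 j hj.1 hij with hd | ⟨hs, hr⟩ | ⟨hs, hr⟩
    · exact hd
    · exact absurd hr (hi.2 j hj.1 hs)
    · exact absurd hr (hj.2 i hi.1 hs)
  · intro i hi
    obtain ⟨j, hj, hmax⟩ := (F.filter fun j => Q i ⊆ Q j).exists_max_image r
      ⟨i, by simp [hi]⟩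
    simp only [Finset.mem_filter] at hj hmax
    refine ⟨j, ?_, hj.2⟩
    simp only [Finset.mem_filter]
    exact ⟨hj.1, fun k hk hjk => not_lt.mpr (hmax k ⟨hk, hj.2.trans hjk⟩)⟩

/-- If the average of `f` over each member of a laminar family is at least `t`, then so is its
average over the union. -/
theorem Laminar.mul_measure_biUnion_le {ι X : Type*} [MeasurableSpace X] {ν : Measure X}
    {F : Finset ι} {Q : ι → Set X} {r : ι → ℝ≥0} (h : Laminar F Q r)
    (hQ : ∀ i ∈ F, MeasurableSet (Q i)) {f : X → ℝ≥0∞} {t : ℝ≥0∞}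
    (ht : ∀ i ∈ F, t * ν (Q i) ≤ ∫⁻ x in Q i, f x ∂ν) :
    t * ν (⋃ i ∈ F, Q i) ≤ ∫⁻ x in ⋃ i ∈ F, Q i, f x ∂ν := by
  obtain ⟨G, hG, hd, hc⟩ := h.exists_maximal
  have hU : ⋃ i ∈ F, Q i = ⋃ i ∈ G, Q i := by
    refine subset_antisymm (Set.iUnion₂_subset fun i hi => ?_) (Set.biUnion_mono hG fun _ _ => le_rfl)
    obtain ⟨j, hj, hij⟩ := hc i hi
    exact hij.trans (Set.subset_biUnion_of_mem (u := Q) hj)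
  rw [hU, measure_biUnion_finset hd fun i hi => hQ i (hG hi),
    lintegral_biUnion_finset hd fun i hi => hQ i (hG hi), Finset.mul_sum]
  exact Finset.sum_le_sum fun i hi => ht i (hG hi)

/-! ### The Carleson embedding theorem -/

theorem sum_biUnion_le {ι κ : Type*} [DecidableEq κ] (s : Finset ι) (t : ι → Finset κ)
    (c : κ → ℝ≥0∞) : ∑ k ∈ s.biUnion t, c k ≤ ∑ i ∈ s, ∑ k ∈ t i, c k := by
  classical
  induction s using Finset.induction_on with
  | empty => simp
  | insert i s hi ih =>
    rw [Finset.biUnion_insert, Finset.sum_insert hi]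
    refine le_trans ?_ (add_le_add le_rfl ih)
    rw [← Finset.sum_union_inter]
    exact le_self_add

/-- Weak-type estimate for disjoint sets on which `f` has average at least `t`: only the part of
`f` above `t / 2` matters. -/
theorem sum_measure_le_of_lt_average {ι X : Type*} [MeasurableSpace X] {ν : Measure X}
    {G : Finset ι} {Q : ι → Set X} (hd : (G : Set ι).PairwiseDisjoint Q)
    (hQ : ∀ i ∈ G, MeasurableSet (Q i)) (hfin : ∀ i ∈ G, ν (Q i) ≠ ∞) {f : X → ℝ} {t : ℝ}
    (ht : 0 < t) (h : ∀ i ∈ G, ENNReal.ofReal t * ν (Q i) ≤ ∫⁻ x in Q i, ‖f x‖ₑ ∂ν) :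
    ENNReal.ofReal t * ∑ i ∈ G, ν (Q i) ≤
      2 * ν.withDensity (fun x => ‖f x‖ₑ) {x | t < 2 * ‖f x‖} := by
  set ρ := ν.withDensity (fun x => ‖f x‖ₑ)
  set T := {x | t < 2 * ‖f x‖}
  -- Off `T` the function is at most `t / 2`, which accounts for at most half of `t ν(Q i)`; that
  -- half is finite and can be subtracted.
  have key : ∀ i ∈ G, ENNReal.ofReal t * ν (Q i) ≤ 2 * ρ.restrict T (Q i) := by
    intro i hi
    have h1 : ∫⁻ x in Q i, ‖f x‖ₑ ∂ν ≤ ρ.restrict T (Q i) + ENNReal.ofReal (t / 2) * ν (Q i) := by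
      have hU : Q i = (Q i ∩ T) ∪ (Q i \ T) := (Set.inter_union_sdiff _ _).symm
      calc ∫⁻ x in Q i, ‖f x‖ₑ ∂ν
          = ∫⁻ x in (Q i ∩ T) ∪ (Q i \ T), ‖f x‖ₑ ∂ν := by rw [← hU]
        _ ≤ ∫⁻ x in Q i ∩ T, ‖f x‖ₑ ∂ν + ∫⁻ x in Q i \ T, ‖f x‖ₑ ∂ν := lintegral_union_le _ _ _
        _ ≤ _ := by
          gcongr
          · rw [Measure.restrict_apply (hQ i hi)]
            exact withDensity_apply_le _ _
          · calc ∫⁻ x in Q i \ T, ‖f x‖ₑ ∂ν ≤ ∫⁻ x in Q i \ T, ENNReal.ofReal (t / 2) ∂ν := by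
                  refine setLIntegral_mono measurable_const fun x hx => ?_
                  rw [← ofReal_norm]
                  have := hx.2
                  simp only [T, Set.mem_ofPred_eq, not_lt] at this
                  exact ENNReal.ofReal_le_ofReal (by linarith)
              _ = ENNReal.ofReal (t / 2) * ν (Q i \ T) := setLIntegral_const _ _
              _ ≤ _ := by gcongr; exact Set.sdiff_subset
    have h2 : ENNReal.ofReal t = ENNReal.ofReal (t / 2) + ENNReal.ofReal (t / 2) := by
      rw [← ENNReal.ofReal_add (by positivity) (by positivity)]; congr 1; ring
    have h3 := (h i hi).trans h1
    rw [h2, add_mul] at h3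
    have h4 := (ENNReal.add_le_add_iff_right
      (ENNReal.mul_ne_top ENNReal.ofReal_ne_top (hfin i hi))).1 h3
    rw [h2, add_mul, two_mul]
    exact add_le_add h4 h4
  calc ENNReal.ofReal t * ∑ i ∈ G, ν (Q i) ≤ ∑ i ∈ G, 2 * ρ.restrict T (Q i) := by
        rw [Finset.mul_sum]; exact Finset.sum_le_sum key
    _ = 2 * ρ.restrict T (⋃ i ∈ G, Q i) := by
        rw [measure_biUnion_finset hd hQ, Finset.mul_sum]
    _ ≤ 2 * ρ.restrict T Set.univ := by gcongr; exact Set.subset_univ _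
    _ = _ := by rw [Measure.restrict_apply_univ]

/-- The constant in the dyadic Carleson embedding theorem. -/
def embeddingConst (p : ℝ) : ℝ := 2 * p / (p - 1) * 2 ^ (p - 1)

/-- **Carleson embedding theorem** for a finite laminar family. -/
theorem Laminar.carleson_embedding {ι X : Type*} [MeasurableSpace X] {ν : Measure X}
    {F : Finset ι} {Q : ι → Set X} {r : ι → ℝ≥0} (hF : Laminar F Q r)
    (hQ : ∀ i ∈ F, MeasurableSet (Q i)) (hfin : ∀ i ∈ F, ν (Q i) ≠ ∞)
    {p : ℝ} (hp : 1 < p) {f : X → ℝ} (hf : AEMeasurable f ν) {c : ι → ℝ≥0∞} {A : ℝ≥0∞}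
    {a : ι → ℝ} (ha : ∀ i, 0 ≤ a i)
    (haf : ∀ i ∈ F, ENNReal.ofReal (a i) * ν (Q i) ≤ ∫⁻ x in Q i, ‖f x‖ₑ ∂ν)
    (hc : ∀ i ∈ F, ∀ G ⊆ F, (∀ j ∈ G, Q j ⊆ Q i) → ∑ j ∈ G, c j ≤ A * ν (Q i)) :
    ∑ i ∈ F, c i * ENNReal.ofReal (a i ^ p) ≤
      ENNReal.ofReal (embeddingConst p) * A * ∫⁻ x, ‖f x‖ₑ ^ p ∂ν := by
  classical
  let _ : MeasurableSpace ι := ⊤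
  -- With the coefficients as point masses on the index set, the sum becomes an integral to which
  -- the layer-cake formula applies.
  set κ : Measure ι := ∑ i ∈ F, c i • Measure.dirac i with hκ
  set ρ := ν.withDensity (fun x => ‖f x‖ₑ) with hρ
  have hκF : ∀ s : Set ι, κ s = ∑ i ∈ F with i ∈ s, c i := by
    intro s
    simp only [hκ, Measure.coe_finsetSum, Finset.sum_apply, Measure.smul_apply, smul_eq_mul]
    rw [Finset.sum_filter]
    refine Finset.sum_congr rfl fun i _ => ?_
    rw [Measure.dirac_apply' _ (MeasurableSpace.measurableSet_top)]
    by_cases his : i ∈ s <;> simp [his]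
  have hlevel : ∀ t : ℝ, 0 < t →
      ENNReal.ofReal t * κ {i | t < a i} ≤ 2 * A * ρ {x | t < 2 * ‖f x‖} := by
    intro t ht
    set Ft := F.filter fun i => t < a i with hFt
    have hFtF : Ft ⊆ F := Finset.filter_subset _ _
    obtain ⟨G, hG, hd, hcov⟩ := (hF.mono hFtF).exists_maximal
    have hGF := hG.trans hFtF
    -- Each member with `a i > t` lies in a maximal such member, where the Carleson condition
    -- applies.
    have h1 : κ {i | t < a i} ≤ A * ∑ j ∈ G, ν (Q j) := by
      rw [hκF]
      simp only [Set.mem_ofPred_eq]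
      calc ∑ i ∈ Ft, c i ≤ ∑ i ∈ G.biUnion fun j => Ft.filter fun i => Q i ⊆ Q j, c i := by
            refine Finset.sum_le_sum_of_subset fun i hi => ?_
            obtain ⟨j, hj, hij⟩ := hcov i hi
            exact Finset.mem_biUnion.2 ⟨j, hj, Finset.mem_filter.2 ⟨hi, hij⟩⟩
        _ ≤ ∑ j ∈ G, ∑ i ∈ Ft.filter (fun i => Q i ⊆ Q j), c i := sum_biUnion_le _ _ _
        _ ≤ ∑ j ∈ G, A * ν (Q j) := by
            refine Finset.sum_le_sum fun j hj => hc j (hGF hj) _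
              ((Finset.filter_subset _ _).trans hFtF) fun i hi => (Finset.mem_filter.1 hi).2
        _ = _ := by rw [Finset.mul_sum]
    have h2 := sum_measure_le_of_lt_average (ν := ν) (f := f) hd (fun i hi => hQ i (hGF hi))
      (fun i hi => hfin i (hGF hi)) ht (fun i hi => by
        refine le_trans ?_ (haf i (hGF hi))
        gcongr
        exact (Finset.mem_filter.1 (hG hi)).2.le)
    calc ENNReal.ofReal t * κ {i | t < a i} ≤ ENNReal.ofReal t * (A * ∑ j ∈ G, ν (Q j)) := by gcongr
      _ = A * (ENNReal.ofReal t * ∑ j ∈ G, ν (Q j)) := by ring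
      _ ≤ A * (2 * ρ {x | t < 2 * ‖f x‖}) := by gcongr
      _ = _ := by ring
  have hsum : ∑ i ∈ F, c i * ENNReal.ofReal (a i ^ p) = ∫⁻ i, ENNReal.ofReal (a i ^ p) ∂κ := by
    simp only [hκ]
    rw [lintegral_finsetSum_measure]
    refine Finset.sum_congr rfl fun i _ => ?_
    rw [lintegral_smul_measure, lintegral_dirac' _ measurable_from_top, smul_eq_mul]
  have hfρ : AEMeasurable (fun x => 2 * ‖f x‖) ρ :=
    ((hf.norm).const_mul 2).mono_ac (withDensity_absolutelyContinuous _ _)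
  have hp1 : 0 < p - 1 := by linarith
  -- Layer cake for the exponent `p - 1` with respect to `|f| ν`; the density supplies the missing
  -- power of `|f|`, and `2 ^ (p - 1)` comes from the level sets of `2 |f|`.
  have hlast : ENNReal.ofReal (p - 1) *
      ∫⁻ t : ℝ in Set.Ioi 0, ρ {x | t < 2 * ‖f x‖} * ENNReal.ofReal (t ^ (p - 1 - 1)) =
      ENNReal.ofReal (2 ^ (p - 1)) * ∫⁻ x, ‖f x‖ₑ ^ p ∂ν := by
    rw [← lintegral_rpow_eq_lintegral_meas_lt_mul ρ (Eventually.of_forall fun x => by positivity)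
      hfρ hp1, hρ, lintegral_withDensity_eq_lintegral_mul₀ hf.enorm,
      ← lintegral_const_mul' _ _ ENNReal.ofReal_ne_top]
    · refine lintegral_congr fun x => ?_
      simp only [Pi.mul_apply]
      rw [Real.mul_rpow (by norm_num) (norm_nonneg _), ENNReal.ofReal_mul (by positivity),
        ← ENNReal.ofReal_rpow_of_nonneg (norm_nonneg _) hp1.le, ofReal_norm]
      have : ‖f x‖ₑ ^ p = ‖f x‖ₑ * ‖f x‖ₑ ^ (p - 1) := by
        conv_rhs => rw [← ENNReal.rpow_one ‖f x‖ₑ, ← ENNReal.rpow_mul, one_mul]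
        rw [← ENNReal.rpow_add_of_nonneg _ _ (by norm_num) hp1.le]
        congr 1; ring
      rw [this]; ring
    · exact (((hf.norm).const_mul 2).pow_const (p - 1)).ennreal_ofReal
  -- The weak-type bound costs one factor `t`, which lowers the exponent from `p - 1` to `p - 2`.
  have hmid : ∫⁻ t : ℝ in Set.Ioi 0, κ {i | t < a i} * ENNReal.ofReal (t ^ (p - 1)) ≤
      ∫⁻ t : ℝ in Set.Ioi 0, 2 * A * (ρ {x | t < 2 * ‖f x‖} * ENNReal.ofReal (t ^ (p - 1 - 1))) := by
    refine lintegral_mono_ae ((ae_restrict_iff' measurableSet_Ioi).2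
      (Eventually.of_forall fun t (ht : 0 < t) => ?_))
    have : t ^ (p - 1) = t * t ^ (p - 1 - 1) := by
      rw [Real.rpow_sub_one ht.ne' (p - 1)]; field_simp
    rw [this, ENNReal.ofReal_mul ht.le, ← mul_assoc, mul_comm (κ _), ← mul_assoc]
    exact mul_le_mul_left (hlevel t ht) _
  have hmeas : Measurable fun t : ℝ =>
      ρ {x | t < 2 * ‖f x‖} * ENNReal.ofReal (t ^ (p - 1 - 1)) := by
    refine Measurable.mul ?_ (by fun_prop)
    exact Antitone.measurable fun s t hst => measure_mono fun x (hx : t < _) => lt_of_le_of_lt hst hx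
  rw [hsum, lintegral_rpow_eq_lintegral_meas_lt_mul κ (Eventually.of_forall ha)
    measurable_from_top.aemeasurable (by linarith)]
  refine (mul_le_mul_right hmid _).trans ?_
  rw [lintegral_const_mul _ hmeas]
  set I := ∫⁻ t : ℝ in Set.Ioi 0, ρ {x | t < 2 * ‖f x‖} * ENNReal.ofReal (t ^ (p - 1 - 1))
  have hpp : ENNReal.ofReal p = ENNReal.ofReal (p / (p - 1)) * ENNReal.ofReal (p - 1) := by
    rw [← ENNReal.ofReal_mul (by positivity)]; congr 1; field_simp
  have hconst : ENNReal.ofReal (embeddingConst p) =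
      2 * ENNReal.ofReal (p / (p - 1)) * ENNReal.ofReal (2 ^ (p - 1)) := by
    rw [embeddingConst, ← ENNReal.ofReal_ofNat 2, ← ENNReal.ofReal_mul (by norm_num),
      ← ENNReal.ofReal_mul (by positivity)]
    congr 1; ring
  calc ENNReal.ofReal p * (2 * A * I)
      = 2 * ENNReal.ofReal (p / (p - 1)) * A * (ENNReal.ofReal (p - 1) * I) := by rw [hpp]; ring
    _ ≤ _ := by rw [hlast, hconst]; exact le_of_eq (by ring)

/-! ### Sparse subfamilies -/

/-- Every finite laminar family with positive averages `w` contains a sparse subfamily whose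
averages control those of the whole family. -/
theorem Laminar.exists_sparse {ι X : Type*} [MeasurableSpace X] {ν : Measure X}
    {F : Finset ι} {Q : ι → Set X} {r : ι → ℝ≥0} (hF : Laminar F Q r)
    (hQ : ∀ i ∈ F, MeasurableSet (Q i)) (hfin : ∀ i ∈ F, ν (Q i) ≠ ∞)
    {g : X → ℝ≥0∞} {w : ι → ℝ} (hw : ∀ i ∈ F, 0 < w i)
    (hg : ∀ i ∈ F, ∫⁻ x in Q i, g x ∂ν = ENNReal.ofReal (w i) * ν (Q i)) :
    ∃ S ⊆ F, (∀ i ∈ F, ∃ s ∈ S, Q i ⊆ Q s ∧ r i ≤ r s ∧ w i ≤ 2 * w s) ∧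
      ∀ (G : Finset ι), G ⊆ S → ∀ (b : ι → ℝ≥0∞) (h : X → ℝ≥0∞) (R : Set X),
        (∀ i ∈ G, Q i ⊆ R) → (∀ i ∈ G, ∀ x ∈ Q i, b i ≤ h x) →
        ∑ i ∈ G, ν (Q i) * b i ≤ 4 * ∫⁻ x in R, h x ∂ν := by
  classical
  set lev : ι → ℤ := fun i => Int.log 2 (w i) with hlev
  have hle : ∀ i ∈ F, (2 : ℝ) ^ lev i ≤ w i := fun i hi => by
    exact_mod_cast Int.zpow_log_le_self (b := 2) (by norm_num) (hw i hi)
  have hlt : ∀ i, w i < (2 : ℝ) ^ (lev i + 1) := fun i => by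
    exact_mod_cast Int.lt_zpow_succ_log_self (b := 2) (by norm_num) (w i)
  -- Stopping rule: keep a member if its dyadic level exceeds that of all its strictly larger
  -- ancestors.
  set S := F.filter fun i => ∀ j ∈ F, Q i ⊆ Q j → r i < r j → lev j < lev i with hS
  have hSF : S ⊆ F := Finset.filter_subset _ _
  have hSlev : ∀ i ∈ S, ∀ j ∈ F, Q i ⊆ Q j → r i < r j → lev j < lev i :=
    fun i hi => (Finset.mem_filter.1 hi).2
  refine ⟨S, hSF, ?_, ?_⟩
  · intro i hi
    set anc := F.filter fun j => Q i ⊆ Q j ∧ r i ≤ r j with hanc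
    have hianc : i ∈ anc := by simp [hanc, hi]
    -- The dominating member is the largest among the ancestors of highest level; equality of
    -- integer levels up to rounding costs the factor 2.
    obtain ⟨k, hk, hkmax⟩ := anc.exists_max_image lev ⟨i, hianc⟩
    obtain ⟨s, hs, hsmax⟩ := (anc.filter fun j => lev j = lev k).exists_max_image r
      ⟨k, by simp [hk]⟩
    obtain ⟨hs1, hs2⟩ := Finset.mem_filter.1 hs
    obtain ⟨hsF, hsub, hr⟩ := Finset.mem_filter.1 hs1
    refine ⟨s, Finset.mem_filter.2 ⟨hsF, fun j hj hsj hrj => ?_⟩, hsub, hr, ?_⟩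
    · have hjanc : j ∈ anc := Finset.mem_filter.2 ⟨hj, hsub.trans hsj, hr.trans hrj.le⟩
      have h1 := hkmax j hjanc
      rw [hs2]
      refine lt_of_le_of_ne h1 fun h2 => ?_
      exact absurd hrj (not_lt.2 (hsmax j (Finset.mem_filter.2 ⟨hjanc, h2⟩)))
    · have h1 : lev i ≤ lev s := hs2 ▸ hkmax i hianc
      have h2 : (2 : ℝ) ^ (lev i + 1) ≤ 2 ^ (lev s + 1) :=
        zpow_le_zpow_right₀ (by norm_num) (by linarith)
      have h3 := hle s hsF
      rw [zpow_add_one₀ (by norm_num), zpow_add_one₀ (by norm_num)] at h2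
      have h4 := hlt i
      rw [zpow_add_one₀ (by norm_num)] at h4
      linarith
  -- Two levels up, averages are at least twice the average over `Q s`, so these members cover at
  -- most half of `Q s`. A gap of one level would not ensure this, hence the later split by parity.
  · set bad : ι → Finset ι := fun s => S.filter fun j => Q j ⊆ Q s ∧ lev s + 2 ≤ lev j with hbad
    set E : ι → Set X := fun s => Q s \ ⋃ j ∈ bad s, Q j with hE
    have hbadF : ∀ s, bad s ⊆ F := fun s => (Finset.filter_subset _ _).trans hSF
    have hEm : ∀ s ∈ S, MeasurableSet (E s) := fun s hs =>
      (hQ s (hSF hs)).diff (Finset.measurableSet_biUnion _ fun j hj => hQ j (hbadF s hj))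
    have hEbig : ∀ s ∈ S, ν (Q s) ≤ 2 * ν (E s) := by
      intro s hs
      set U := ⋃ j ∈ bad s, Q j with hU
      have hUs : U ⊆ Q s := Set.iUnion₂_subset fun j hj => (Finset.mem_filter.1 hj).2.1
      have h1 : ENNReal.ofReal (2 ^ (lev s + 2)) * ν U ≤ ∫⁻ x in U, g x ∂ν := by
        refine (hF.mono (hbadF s)).mul_measure_biUnion_le (fun j hj => hQ j (hbadF s hj)) ?_
        intro j hj
        rw [hg j (hbadF s hj)]
        gcongr
        exact (zpow_le_zpow_right₀ (by norm_num) (Finset.mem_filter.1 hj).2.2).trans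
          (hle j (hbadF s hj))
      have h2 : ENNReal.ofReal (2 ^ (lev s + 2)) * ν U ≤
          ENNReal.ofReal (2 ^ (lev s + 1)) * ν (Q s) := by
        refine h1.trans ((lintegral_mono_set hUs).trans ?_)
        rw [hg s (hSF hs)]
        gcongr
        exact (hlt s).le
      have h3 : 2 * ν U ≤ ν (Q s) := by
        have h4 : ENNReal.ofReal ((2 : ℝ) ^ (lev s + 2)) =
            ENNReal.ofReal (2 ^ (lev s + 1)) * 2 := by
          rw [← ENNReal.ofReal_ofNat 2, ← ENNReal.ofReal_mul (by positivity),
            ← zpow_add_one₀ (by norm_num)]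
          congr 2
          ring
        rw [h4, mul_assoc] at h2
        exact (ENNReal.mul_le_mul_iff_right (ENNReal.ofReal_pos.2 (by positivity)).ne' ENNReal.ofReal_ne_top).1 h2
      have h5 : ν (Q s) ≤ ν U + ν (E s) := by
        refine (measure_mono ?_).trans (measure_union_le _ _)
        intro x hx
        by_cases hxU : x ∈ U
        · exact Or.inl hxU
        · exact Or.inr ⟨hx, hxU⟩
      have hUfin : ν U ≠ ∞ := ne_top_of_le_ne_top (hfin s (hSF hs)) (measure_mono hUs)
      have h6 : ν U ≤ ν (E s) := by
        rw [two_mul] at h3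
        exact (ENNReal.add_le_add_iff_left hUfin).1 (h3.trans h5)
      calc ν (Q s) ≤ ν U + ν (E s) := h5
        _ ≤ ν (E s) + ν (E s) := by gcongr
        _ = _ := (two_mul _).symm
    -- members of `S` with levels of the same parity have disjoint `E`
    have hdisj : ∀ i ∈ S, ∀ j ∈ S, i ≠ j → (Even (lev i) ↔ Even (lev j)) →
        Disjoint (E i) (E j) := by
      have aux : ∀ i ∈ S, ∀ j ∈ S, (Even (lev i) ↔ Even (lev j)) → Q i ⊆ Q j → r i < r j →
          Disjoint (E i) (E j) := by
        intro i hi j hj hpar hsub hr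
        have h1 := hSlev i hi j (hSF hj) hsub hr
        have h2 : lev j + 2 ≤ lev i := by
          by_contra hcon
          have : lev i = lev j + 1 := by omega
          rw [this, Int.even_add_one] at hpar
          tauto
        refine Set.disjoint_left.2 fun x hx hx' => hx'.2 ?_
        exact Set.mem_biUnion (x := i) (Finset.mem_filter.2 ⟨hi, hsub, h2⟩) hx.1
      intro i hi j hj hij hpar
      rcases hF i (hSF hi) j (hSF hj) hij with hd | ⟨hs, hr⟩ | ⟨hs, hr⟩
      · exact hd.mono Set.sdiff_subset Set.sdiff_subset
      · exact aux i hi j hj hpar hs hr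
      · exact (aux j hj i hi hpar.symm hs hr).symm
    intro G hG b h R hR hb
    -- Within one parity class the sets `E i` are disjoint and carry half the measure of `Q i`; the
    -- two classes turn 2 into 4.
    have part : ∀ P : Finset ι, P ⊆ G → (∀ i ∈ P, ∀ j ∈ P, (Even (lev i) ↔ Even (lev j))) →
        ∑ i ∈ P, ν (Q i) * b i ≤ 2 * ∫⁻ x in R, h x ∂ν := by
      intro P hP hpar
      have hPS := hP.trans hG
      calc ∑ i ∈ P, ν (Q i) * b i ≤ ∑ i ∈ P, 2 * ∫⁻ x in E i, h x ∂ν := by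
            refine Finset.sum_le_sum fun i hi => ?_
            calc ν (Q i) * b i ≤ 2 * ν (E i) * b i := by gcongr; exact hEbig i (hPS hi)
              _ = 2 * ∫⁻ x in E i, b i ∂ν := by rw [setLIntegral_const]; ring
              _ ≤ _ := by
                gcongr 2 * ?_
                exact setLIntegral_mono' (hEm i (hPS hi)) fun x hx => hb i (hP hi) x hx.1
        _ = 2 * ∫⁻ x in ⋃ i ∈ P, E i, h x ∂ν := by
            rw [lintegral_biUnion_finset _ fun i hi => hEm i (hPS hi), Finset.mul_sum]
            exact fun i hi j hj hij => hdisj i (hPS hi) j (hPS hj) hij (hpar i hi j hj)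
        _ ≤ _ := by
            gcongr
            exact Set.iUnion₂_subset fun i hi => Set.sdiff_subset.trans (hR i (hP hi))
    rw [← Finset.sum_filter_add_sum_filter_not G fun i => Even (lev i)]
    calc _ ≤ 2 * ∫⁻ x in R, h x ∂ν + 2 * ∫⁻ x in R, h x ∂ν := by
          refine add_le_add (part _ (Finset.filter_subset _ _) ?_)
            (part _ (Finset.filter_subset _ _) ?_)
          · intro i hi j hj
            have := (Finset.mem_filter.1 hi).2
            have := (Finset.mem_filter.1 hj).2
            tauto
          · intro i hi j hj
            have := (Finset.mem_filter.1 hi).2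
            have := (Finset.mem_filter.1 hj).2
            tauto
      _ = _ := by rw [← add_mul]; norm_num

/-! ### Cubes and Hölder's inequality for Luxemburg norms -/

theorem Cube.measurableSet {n : ℕ} (Q : Cube n) : MeasurableSet Q.set :=
  MeasurableSet.univ_pi fun _ => measurableSet_Ico

theorem Cube.measurableSet_tent {n : ℕ} (Q : Cube n) : MeasurableSet Q.tent :=
  (measurable_fst Q.measurableSet).inter (measurableSet_lt (by fun_prop) measurable_const)

theorem Cube.volume_eq {n : ℕ} (Q : Cube n) : volume Q.set = (Q.side : ℝ≥0∞) ^ n := by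
  simp [Cube.set, Real.volume_pi_Ico, ENNReal.ofReal_coe_nnreal]

theorem Cube.volume_ne_top {n : ℕ} (Q : Cube n) : volume Q.set ≠ ∞ := by
  rw [Q.volume_eq]; exact ENNReal.pow_ne_top ENNReal.coe_ne_top

theorem Cube.volume_ne_zero {n : ℕ} (Q : Cube n) : volume Q.set ≠ 0 := by
  rw [Q.volume_eq]; exact pow_ne_zero _ (by simpa using Q.side_pos.ne')

theorem div_volume_le_one_iff {n : ℕ} (Q : Cube n) {a : ℝ≥0∞} :
    a / volume Q.set ≤ 1 ↔ a ≤ volume Q.set := by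
  rw [ENNReal.div_le_iff Q.volume_ne_zero Q.volume_ne_top, one_mul]

/-- Young's inequality for a Young function and a complementary function. -/
theorem IsComplementary.mul_le_add {Φ : ℝ≥0 → ℝ≥0} {Ψ : ℝ≥0 → ℝ≥0∞} (h : IsComplementary Φ Ψ)
    (s t : ℝ≥0) : (s : ℝ≥0∞) * t ≤ 2 * (Φ s + Ψ t) := by
  by_cases hΨ : Ψ t = ∞
  · simp [hΨ]
  lift Ψ t to ℝ≥0 using hΨ with b hb
  -- At the common argument `max (Φ s) (Ψ t)` the two inverses dominate `s` and `t`, and their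
  -- product is at most twice this argument.
  have h1 : (s : ℝ≥0∞) ≤ youngInv (fun s => (Φ s : ℝ≥0∞)) (max (Φ s) b) :=
    le_iSup₂ (f := fun (s : ℝ≥0) (_ : (Φ s : ℝ≥0∞) ≤ _) => (s : ℝ≥0∞)) s
      (by exact_mod_cast le_max_left _ _)
  have h2 : (t : ℝ≥0∞) ≤ youngInv Ψ (max (Φ s) b) :=
    le_iSup₂ (f := fun (s : ℝ≥0) (_ : Ψ s ≤ _) => (s : ℝ≥0∞)) t
      (by rw [← hb]; exact_mod_cast le_max_right _ _)
  refine (mul_le_mul' h1 h2).trans ((h.mul_le _).trans ?_)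
  gcongr
  exact_mod_cast max_le_add_of_nonneg (zero_le) (zero_le)

/-- A function of vanishing Luxemburg norm vanishes almost everywhere. -/
theorem ae_eq_zero_of_luxNorm_eq_zero {n : ℕ} {Ψ : ℝ≥0 → ℝ≥0∞} (hm : Measurable Ψ)
    (ht : Tendsto Ψ atTop (𝓝 ∞)) {Q : Cube n} {f : (Fin n → ℝ) → ℝ}
    (hf : AEMeasurable f (volume.restrict Q.set)) (h : luxNorm Ψ Q f = 0) :
    ∀ᵐ x ∂volume.restrict Q.set, f x = 0 := by
  have key : ∀ ε : ℝ≥0, 0 < ε → volume.restrict Q.set {x | ε ≤ ‖f x‖₊} = 0 := by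
    intro ε hε
    -- Chebyshev: arbitrarily small `r` are admissible, so `Ψ (|f| / r)` exceeds any `N` where `|f|
    -- ≥ ε`, while its integral stays at most `|Q|`.
    have hN : ∀ N : ℝ≥0, (N : ℝ≥0∞) * volume.restrict Q.set {x | ε ≤ ‖f x‖₊} ≤ volume Q.set := by
      intro N
      obtain ⟨s, hs⟩ := eventually_atTop.1 (ENNReal.tendsto_nhds_top_iff_nnreal.1 ht N)
      have hpos : 0 < ε / max s 1 := div_pos hε (lt_max_of_lt_right one_pos)
      have hlt : luxNorm Ψ Q f < (ε / max s 1 : ℝ≥0) := by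
        rw [h]; exact_mod_cast hpos
      simp only [luxNorm, iInf_lt_iff] at hlt
      obtain ⟨r, hr, hr1, hr2⟩ := hlt
      rw [div_volume_le_one_iff] at hr1
      have hr3 : r < ε / max s 1 := by exact_mod_cast hr2
      have hmeas : AEMeasurable (fun x => Ψ (‖f x‖₊ / r)) (volume.restrict Q.set) :=
        hm.comp_aemeasurable (hf.nnnorm.div_const r)
      refine le_trans ?_ ((mul_meas_ge_le_lintegral₀ hmeas N).trans hr1)
      gcongr with x
      intro hx
      refine (hs _ ?_).le
      rw [lt_div_iff₀ (lt_max_of_lt_right one_pos)] at hr3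
      rw [le_div_iff₀ hr]
      calc s * r ≤ r * max s 1 := by rw [mul_comm]; gcongr; exact le_max_left _ _
        _ ≤ ‖f x‖₊ := hr3.le.trans hx
    by_contra hne
    have hle : (∞ : ℝ≥0∞) ≤ volume Q.set := by
      have : Tendsto (fun N : ℝ≥0 => (N : ℝ≥0∞) * volume.restrict Q.set {x | ε ≤ ‖f x‖₊})
          atTop (𝓝 (∞ * volume.restrict Q.set {x | ε ≤ ‖f x‖₊})) :=
        ENNReal.Tendsto.mul_const (ENNReal.tendsto_coe_nhds_top.2 tendsto_id) (Or.inl ENNReal.top_ne_zero)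
      rw [ENNReal.top_mul hne] at this
      exact le_of_tendsto' this hN
    exact Q.volume_ne_top (top_le_iff.1 hle)
  have hall : ∀ᵐ x ∂volume.restrict Q.set, ∀ k : ℕ, ‖f x‖₊ < 1 / ((k : ℝ≥0) + 1) := by
    refine ae_all_iff.2 fun k => ?_
    rw [ae_iff]
    simpa only [not_lt] using key (1 / ((k : ℝ≥0) + 1)) (by positivity)
  filter_upwards [hall] with x hx
  by_contra hne
  obtain ⟨k, hk⟩ := exists_nat_one_div_lt (norm_pos_iff.2 hne)
  exact lt_asymm hk (by exact_mod_cast hx k)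

/-- Hölder's inequality for localized Luxemburg norms. -/
theorem IsComplementary.lintegral_mul_le {n : ℕ} {Φ : ℝ≥0 → ℝ≥0} {Ψ : ℝ≥0 → ℝ≥0∞}
    (h : IsComplementary Φ Ψ) (hΦ : IsYoung Φ) (Q : Cube n) {u v : (Fin n → ℝ) → ℝ}
    (hu : AEMeasurable u (volume.restrict Q.set)) (hv : AEMeasurable v (volume.restrict Q.set)) :
    ∫⁻ x in Q.set, ‖u x‖ₑ * ‖v x‖ₑ ≤
      4 * luxNorm (fun s => (Φ s : ℝ≥0∞)) Q u * luxNorm Ψ Q v * volume Q.set := by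
  have hΦm : Measurable fun s => (Φ s : ℝ≥0∞) := hΦ.continuous.measurable.coe_nnreal_ennreal
  have hΨm : Measurable Ψ := h.isExtYoung.lowerSemicontinuous.measurable
  -- Vanishing norms are treated first, since the bound could otherwise read `0 * ∞ = 0`.
  by_cases hu0 : luxNorm (fun s => (Φ s : ℝ≥0∞)) Q u = 0
  · have := ae_eq_zero_of_luxNorm_eq_zero hΦm (ENNReal.tendsto_coe_nhds_top.2 hΦ.tendsto) hu hu0
    rw [lintegral_congr_ae (g := 0) (by filter_upwards [this] with x hx; simp [hx])]
    simp
  by_cases hv0 : luxNorm Ψ Q v = 0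
  · have := ae_eq_zero_of_luxNorm_eq_zero hΨm h.isExtYoung.tendsto hv hv0
    rw [lintegral_congr_ae (g := 0) (by filter_upwards [this] with x hx; simp [hx])]
    simp
  -- The 4 is the 2 of Young's inequality times the two integrals, each at most `|Q|`. The infima
  -- over `r'` and then `r` follow.
  have hr : ∀ r : ℝ≥0, 0 < r → (∫⁻ x in Q.set, (Φ (‖u x‖₊ / r) : ℝ≥0∞)) / volume Q.set ≤ 1 →
      ∀ r' : ℝ≥0, 0 < r' → (∫⁻ x in Q.set, Ψ (‖v x‖₊ / r')) / volume Q.set ≤ 1 →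
      ∫⁻ x in Q.set, ‖u x‖ₑ * ‖v x‖ₑ ≤ 4 * volume Q.set * r * r' := by
    intro r hr hr1 r' hr' hr1'
    rw [div_volume_le_one_iff] at hr1 hr1'
    calc ∫⁻ x in Q.set, ‖u x‖ₑ * ‖v x‖ₑ
        ≤ ∫⁻ x in Q.set, (r * r' * 2 : ℝ≥0) * ((Φ (‖u x‖₊ / r) : ℝ≥0∞) + Ψ (‖v x‖₊ / r')) := by
          refine lintegral_mono fun x => ?_
          have h1 : ‖u x‖ₑ * ‖v x‖ₑ =
              (r * r' : ℝ≥0) * (((‖u x‖₊ / r : ℝ≥0) : ℝ≥0∞) * ((‖v x‖₊ / r' : ℝ≥0) : ℝ≥0∞)) := by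
            rw [enorm_eq_nnnorm, enorm_eq_nnnorm]
            norm_cast
            field_simp
          rw [h1]
          refine (mul_le_mul_right (h.mul_le_add _ _) _).trans (le_of_eq ?_)
          push_cast; ring
      _ = (r * r' * 2 : ℝ≥0) * ((∫⁻ x in Q.set, (Φ (‖u x‖₊ / r) : ℝ≥0∞)) +
            ∫⁻ x in Q.set, Ψ (‖v x‖₊ / r')) := by
          rw [lintegral_const_mul' _ _ ENNReal.coe_ne_top, lintegral_add_left']
          exact hΦm.comp_aemeasurable (hu.nnnorm.div_const r)
      _ ≤ (r * r' * 2 : ℝ≥0) * (volume Q.set + volume Q.set) := by gcongr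
      _ = _ := by push_cast; ring
  have hvol : 4 * volume Q.set ≠ 0 := mul_ne_zero (by norm_num) Q.volume_ne_zero
  have hvol' : 4 * volume Q.set ≠ ∞ := ENNReal.mul_ne_top (by norm_num) Q.volume_ne_top
  have hstep : ∀ r : ℝ≥0, 0 < r →
      (∫⁻ x in Q.set, (Φ (‖u x‖₊ / r) : ℝ≥0∞)) / volume Q.set ≤ 1 →
      ∫⁻ x in Q.set, ‖u x‖ₑ * ‖v x‖ₑ ≤ 4 * volume Q.set * luxNorm Ψ Q v * r := by
    intro r hr0 hr1
    have hne : 4 * volume Q.set * r ≠ 0 := mul_ne_zero hvol (by exact_mod_cast hr0.ne')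
    have hne' : 4 * volume Q.set * r ≠ ∞ := ENNReal.mul_ne_top hvol' ENNReal.coe_ne_top
    have : (∫⁻ x in Q.set, ‖u x‖ₑ * ‖v x‖ₑ) / (4 * volume Q.set * r) ≤ luxNorm Ψ Q v := by
      refine le_iInf fun r' => le_iInf fun h0 => le_iInf fun h1 => ?_
      rw [ENNReal.div_le_iff hne hne', mul_comm]
      exact hr r hr0 hr1 r' h0 h1
    rw [ENNReal.div_le_iff hne hne'] at this
    exact this.trans (le_of_eq (by ring))
  by_cases hvt : luxNorm Ψ Q v = ∞
  · rw [hvt, ENNReal.mul_top (mul_ne_zero (by norm_num) hu0), ENNReal.top_mul Q.volume_ne_zero]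
    exact le_top
  have hne : 4 * volume Q.set * luxNorm Ψ Q v ≠ 0 := mul_ne_zero hvol hv0
  have hne' : 4 * volume Q.set * luxNorm Ψ Q v ≠ ∞ := ENNReal.mul_ne_top hvol' hvt
  have : (∫⁻ x in Q.set, ‖u x‖ₑ * ‖v x‖ₑ) / (4 * volume Q.set * luxNorm Ψ Q v) ≤
      luxNorm (fun s => (Φ s : ℝ≥0∞)) Q u := by
    refine le_iInf fun r => le_iInf fun h0 => le_iInf fun h1 => ?_
    rw [ENNReal.div_le_iff hne hne', mul_comm]
    exact hstep r h0 h1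
  rw [ENNReal.div_le_iff hne hne'] at this
  exact this.trans (le_of_eq (by ring))

/-! ### Weights -/

theorem IsWeight.aemeasurable {n : ℕ} {σ : (Fin n → ℝ) → ℝ} (hσ : IsWeight σ) :
    AEMeasurable σ volume :=
  hσ.locallyIntegrable.aestronglyMeasurable.aemeasurable

theorem weightMeasure_cube {n : ℕ} (σ : (Fin n → ℝ) → ℝ) (Q : Cube n) :
    weightMeasure σ Q.set = ∫⁻ x in Q.set, ENNReal.ofReal (σ x) :=
  withDensity_apply _ Q.measurableSet

theorem IsWeight.weightMeasure_cube_ne_top {n : ℕ} {σ : (Fin n → ℝ) → ℝ} (hσ : IsWeight σ)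
    (Q : Cube n) : weightMeasure σ Q.set ≠ ∞ := by
  have hsub : Q.set ⊆ Set.Icc Q.corner (fun i => Q.corner i + Q.side) := fun x hx =>
    ⟨fun i => (hx i trivial).1, fun i => (hx i trivial).2.le⟩
  have hi : IntegrableOn σ Q.set volume :=
    (hσ.locallyIntegrable.integrableOn_isCompact isCompact_Icc).mono_set hsub
  rw [weightMeasure_cube]
  exact hi.lintegral_lt_top.ne

/-- The weight of a cube is controlled by the product of the Luxemburg norms of the two factors
of the weight. -/
theorem IsComplementary.weightMeasure_cube_le {n : ℕ} {Φ : ℝ≥0 → ℝ≥0} {Ψ : ℝ≥0 → ℝ≥0∞}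
    (h : IsComplementary Φ Ψ) (hΦ : IsYoung Φ) {σ : (Fin n → ℝ) → ℝ} (hσ : IsWeight σ)
    {p : ℝ} (hp : 1 < p) (Q : Cube n) :
    weightMeasure σ Q.set ≤
      4 * luxNorm (fun s => (Φ s : ℝ≥0∞)) Q (fun x => σ x ^ (1 / Real.conjExponent p)) *
        luxNorm Ψ Q (fun x => σ x ^ (1 / p)) * volume Q.set := by
  have hm := hσ.aemeasurable.restrict (s := Q.set)
  refine le_trans (le_of_eq ?_) (h.lintegral_mul_le hΦ Q
    (hm.pow_const (1 / Real.conjExponent p)) (hm.pow_const (1 / p)))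
  rw [weightMeasure_cube]
  refine lintegral_congr fun x => ?_
  have hpq := (Real.HolderConjugate.conjExponent hp).symm
  rw [← enorm_mul, ← Real.rpow_add_of_nonneg (hσ.nonneg x) (by simpa using hpq.nonneg)
    (by simpa using hpq.symm.nonneg), one_div, one_div, hpq.inv_add_inv_eq_one, Real.rpow_one,
    Real.enorm_of_nonneg (hσ.nonneg x)]

theorem IsWeight.lintegral_mul {n : ℕ} {σ : (Fin n → ℝ) → ℝ} (hσ : IsWeight σ)
    (f : (Fin n → ℝ) → ℝ) (Q : Cube n) :
    ∫⁻ x in Q.set, ‖f x * σ x‖ₑ = ∫⁻ x in Q.set, ‖f x‖ₑ ∂weightMeasure σ := by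
  rw [weightMeasure, restrict_withDensity Q.measurableSet,
    lintegral_withDensity_eq_lintegral_mul_non_measurable₀ _
      hσ.aemeasurable.restrict.ennreal_ofReal (Eventually.of_forall fun _ => ENNReal.ofReal_lt_top)]
  refine lintegral_congr fun x => ?_
  simp only [Pi.mul_apply]
  rw [enorm_mul, Real.enorm_of_nonneg (hσ.nonneg x), mul_comm]

/-- On a cube `σ` is a finite measure, so `L^p(σ)` embeds in `L^1(σ)` there. This makes all averages
finite, so that levels can be taken. -/
theorem IsWeight.lintegral_mul_ne_top {n : ℕ} {σ : (Fin n → ℝ) → ℝ} (hσ : IsWeight σ)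
    {f : (Fin n → ℝ) → ℝ} {p : ℝ} (hp : 1 < p)
    (hf : MemLp f (ENNReal.ofReal p) (weightMeasure σ)) (Q : Cube n) :
    ∫⁻ x in Q.set, ‖f x * σ x‖ₑ ≠ ∞ := by
  rw [hσ.lintegral_mul]
  have : IsFiniteMeasure ((weightMeasure σ).restrict Q.set) :=
    ⟨by rw [Measure.restrict_apply_univ]; exact (hσ.weightMeasure_cube_ne_top Q).lt_top⟩
  have h1 : MemLp f 1 ((weightMeasure σ).restrict Q.set) :=
    (hf.restrict _).mono_exponent (by simpa using ENNReal.ofReal_le_ofReal hp.le)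
  exact (memLp_one_iff_integrable.1 h1).2.ne

/-! ### The estimate for one laminar family of cubes -/

/-- The average of `|g|` over a cube. -/
def average {n : ℕ} (g : (Fin n → ℝ) → ℝ) (Q : Cube n) : ℝ≥0∞ :=
  (∫⁻ y in Q.set, ‖g y‖ₑ) / volume Q.set

/-- The testing condition contained in the finiteness of `wilsonConst`. -/
theorem lintegral_orliczMaximal_le {n : ℕ} {p : ℝ} {σ : (Fin n → ℝ) → ℝ} (hσ : IsWeight σ)
    (Ψ : ℝ≥0 → ℝ≥0∞) {Q : Cube n} (hQ : weightMeasure σ Q.set ≠ 0) :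
    ∫⁻ x in Q.set, orliczMaximal Ψ (Q.set.indicator fun y => σ y ^ (1 / p)) x ^ p ≤
      wilsonConst p σ Ψ * weightMeasure σ Q.set := by
  rw [← ENNReal.div_le_iff hQ (hσ.weightMeasure_cube_ne_top Q)]
  exact le_iSup (fun Q : Cube n => (∫⁻ x in Q.set,
    orliczMaximal Ψ (Q.set.indicator fun y => σ y ^ (1 / p)) x ^ p) / weightMeasure σ Q.set) Q

/-- Truncation to `R` changes nothing on `Q`, so `Q` competes in the supremum. This is the pointwise
bound fed into the packing estimate. -/
theorem luxNorm_le_orliczMaximal_indicator {n : ℕ} (Ψ : ℝ≥0 → ℝ≥0∞) {Q R : Cube n}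
    (hQR : Q.set ⊆ R.set) (f : (Fin n → ℝ) → ℝ) {x : Fin n → ℝ} (hx : x ∈ Q.set) :
    luxNorm Ψ Q f ≤ orliczMaximal Ψ (R.set.indicator f) x := by
  have h : luxNorm Ψ Q f = luxNorm Ψ Q (R.set.indicator f) := by
    unfold luxNorm
    congr 1; ext r
    rw [setLIntegral_congr_fun Q.measurableSet (g := fun x => Ψ (‖R.set.indicator f x‖₊ / r))]
    intro y hy
    simp only [Set.indicator_of_mem (hQR hy)]
  rw [h]
  exact le_iSup₂ (f := fun (Q : Cube n) (_ : x ∈ Q.set) => luxNorm Ψ Q (R.set.indicator f)) Q hx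

/-- The constant in the estimate for a dyadic maximal operator. -/
def dyadicConst (p : ℝ) : ℝ := 8 ^ p * embeddingConst p * 4

/-- Here `a` plays the role of the `σ`-average of `|f|`. The factor 8 is the 2 of the sparse
domination times the 4 of Hölder's inequality; `bumpConst` absorbs the `Φ`-norm and the tent. -/
theorem rpow_average_mul_tent_le {n : ℕ} {p : ℝ} (hp : 1 < p) {μ : Measure (HalfSpace n)}
    {σ : (Fin n → ℝ) → ℝ} {Φ : ℝ≥0 → ℝ≥0} {Ψ : ℝ≥0 → ℝ≥0∞} (hσ : IsWeight σ) (hΦ : IsYoung Φ)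
    (hΨ : IsComplementary Φ Ψ) {f : (Fin n → ℝ) → ℝ} {Q : Cube n} {a : ℝ≥0∞}
    (ha : ∫⁻ x in Q.set, ‖f x * σ x‖ₑ = a * weightMeasure σ Q.set) :
    (2 * average (fun x => f x * σ x) Q) ^ p * μ Q.tent ≤
      8 ^ p * bumpConst p μ σ Φ *
        (volume Q.set * luxNorm Ψ Q (fun x => σ x ^ (1 / p)) ^ p * a ^ p) := by
  have hp0 : 0 ≤ p := by linarith
  have hv0 := Q.volume_ne_zero
  have hvt := Q.volume_ne_top
  set N := luxNorm (fun s => (Φ s : ℝ≥0∞)) Q (fun x => σ x ^ (1 / Real.conjExponent p))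
  set N' := luxNorm Ψ Q (fun x => σ x ^ (1 / p))
  have h1 : 2 * average (fun x => f x * σ x) Q ≤ 8 * N * N' * a := by
    rw [average, ha, ← mul_div_assoc, ENNReal.div_le_iff hv0 hvt]
    calc 2 * (a * weightMeasure σ Q.set) ≤ 2 * (a * (4 * N * N' * volume Q.set)) := by
          gcongr; exact hΨ.weightMeasure_cube_le hΦ hσ hp Q
      _ = _ := by ring
  have h2 : μ Q.tent / volume Q.set * N ^ p ≤ bumpConst p μ σ Φ :=
    le_iSup (fun Q : Cube n => μ Q.tent / volume Q.set *
      luxNorm (fun s => (Φ s : ℝ≥0∞)) Q (fun x => σ x ^ (1 / Real.conjExponent p)) ^ p) Q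
  calc (2 * average (fun x => f x * σ x) Q) ^ p * μ Q.tent ≤ (8 * N * N' * a) ^ p * μ Q.tent := by
        gcongr
    _ = (8 * N * N' * a) ^ p * (μ Q.tent / volume Q.set * volume Q.set) := by
        rw [ENNReal.div_mul_cancel hv0 hvt]
    _ = 8 ^ p * (μ Q.tent / volume Q.set * N ^ p) * (volume Q.set * N' ^ p * a ^ p) := by
        rw [ENNReal.mul_rpow_of_nonneg _ _ hp0, ENNReal.mul_rpow_of_nonneg _ _ hp0,
          ENNReal.mul_rpow_of_nonneg _ _ hp0]
        ring
    _ ≤ _ := by gcongr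

/-- The estimate for the maximal operator of a finite laminar family of cubes. -/
theorem Laminar.lintegral_maximal_le {ι : Type*} {n : ℕ} {p : ℝ} (hp : 1 < p)
    {μ : Measure (HalfSpace n)} {σ : (Fin n → ℝ) → ℝ} {Φ : ℝ≥0 → ℝ≥0} {Ψ : ℝ≥0 → ℝ≥0∞}
    (hσ : IsWeight σ) (hΦ : IsYoung Φ) (hΨ : IsComplementary Φ Ψ) {f : (Fin n → ℝ) → ℝ}
    (hf : MemLp f (ENNReal.ofReal p) (weightMeasure σ)) {F : Finset ι} {Q : ι → Cube n}
    (hF : Laminar F (fun i => (Q i).set) fun i => (Q i).side) :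
    ∫⁻ z, (⨆ i ∈ F, (Q i).tent.indicator (fun _ => average (fun x => f x * σ x) (Q i)) z) ^ p ∂μ ≤
      ENNReal.ofReal (dyadicConst p) * (bumpConst p μ σ Φ * wilsonConst p σ Ψ) *
        ∫⁻ x, ‖f x‖ₑ ^ p ∂weightMeasure σ := by
  classical
  have hp0 : 0 < p := by linarith
  set g := fun x => f x * σ x with hg
  have hLt : ∀ i, ∫⁻ x in (Q i).set, ‖g x‖ₑ ≠ ∞ := fun i => hσ.lintegral_mul_ne_top hp hf (Q i)
  have havt : ∀ i, average g (Q i) ≠ ∞ := fun i =>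
    ENNReal.div_ne_top (hLt i) (Q i).volume_ne_zero
  set w : ι → ℝ := fun i => (average g (Q i)).toReal with hw
  have hwav : ∀ i, ENNReal.ofReal (w i) = average g (Q i) := fun i => ENNReal.ofReal_toReal (havt i)
  have hL : ∀ i, ∫⁻ x in (Q i).set, ‖g x‖ₑ = ENNReal.ofReal (w i) * volume (Q i).set := fun i => by
    rw [hwav, average, ENNReal.div_mul_cancel (Q i).volume_ne_zero (Q i).volume_ne_top]
  -- Cubes of zero average have no level and contribute nothing; positivity of the average also
  -- forces `σ(Q) ≠ 0`, as needed to divide by it.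
  set P := F.filter fun i => 0 < w i with hP
  have hPF : P ⊆ F := Finset.filter_subset _ _
  have hPw : ∀ i ∈ P, 0 < w i := fun i hi => (Finset.mem_filter.1 hi).2
  obtain ⟨S, hSP, hdom, hpack⟩ := (hF.mono hPF).exists_sparse (ν := volume)
    (fun i _ => (Q i).measurableSet) (fun i _ => (Q i).volume_ne_top) hPw (fun i _ => hL i)
  have hσ0 : ∀ i ∈ P, weightMeasure σ (Q i).set ≠ 0 := fun i hi h0 => by
    have h1 := hL i
    rw [hσ.lintegral_mul, setLIntegral_measure_zero _ _ h0] at h1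
    exact mul_ne_zero (ENNReal.ofReal_pos.2 (hPw i hi)).ne' (Q i).volume_ne_zero h1.symm
  have hpt : ∀ z, (⨆ i ∈ F, (Q i).tent.indicator (fun _ => average g (Q i)) z) ^ p ≤
      ∑ s ∈ S, (Q s).tent.indicator (fun _ => (2 * average g (Q s)) ^ p) z := by
    intro z
    rw [← ENNReal.le_rpow_inv_iff hp0]
    refine iSup₂_le fun i hi => ?_
    rw [ENNReal.le_rpow_inv_iff hp0]
    by_cases hz : z ∈ (Q i).tent
    swap
    · rw [Set.indicator_of_notMem hz, ENNReal.zero_rpow_of_pos hp0]; exact zero_le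
    rw [Set.indicator_of_mem hz]
    by_cases hwi : 0 < w i
    swap
    · have : average g (Q i) = 0 := by
        rw [← hwav]; exact ENNReal.ofReal_of_nonpos (not_lt.1 hwi)
      rw [this, ENNReal.zero_rpow_of_pos hp0]; exact zero_le
    obtain ⟨s, hs, hsub, hr, hws⟩ := hdom i (Finset.mem_filter.2 ⟨hi, hwi⟩)
    -- The comparison of ranks is what makes the tents nest as well as the cubes.
    have hzs : z ∈ (Q s).tent := ⟨hsub hz.1, hz.2.trans_le hr⟩
    refine le_trans ?_ (Finset.single_le_sum (fun _ _ => zero_le) hs)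
    rw [Set.indicator_of_mem hzs, ← hwav i, ← hwav s, ← ENNReal.ofReal_ofNat 2,
      ← ENNReal.ofReal_mul (by norm_num)]
    gcongr
  set a : ι → ℝ := fun i => ((∫⁻ x in (Q i).set, ‖g x‖ₑ) / weightMeasure σ (Q i).set).toReal
  have hLa : ∀ i ∈ P, ∫⁻ x in (Q i).set, ‖g x‖ₑ =
      ENNReal.ofReal (a i) * weightMeasure σ (Q i).set := fun i hi => by
    rw [ENNReal.ofReal_toReal (ENNReal.div_ne_top (hLt i) (hσ0 i hi)),
      ENNReal.div_mul_cancel (hσ0 i hi) (hσ.weightMeasure_cube_ne_top _)]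
  set c : ι → ℝ≥0∞ := fun i =>
    volume (Q i).set * luxNorm Ψ (Q i) (fun x => σ x ^ (1 / p)) ^ p with hc
  -- The Carleson condition: the packing estimate with `b` the `p`-th power of the `Ψ`-norm and `h`
  -- that of the localized Orlicz maximal function, followed by the testing bound.
  have hemb := (hF.mono (hSP.trans hPF)).carleson_embedding (ν := weightMeasure σ)
    (fun i _ => (Q i).measurableSet) (fun i _ => hσ.weightMeasure_cube_ne_top (Q i)) hp
    hf.1.aemeasurable (c := c) (A := 4 * wilsonConst p σ Ψ) (a := a)
    (fun i => ENNReal.toReal_nonneg)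
    (fun i hi => by rw [← hLa i (hSP hi), hσ.lintegral_mul])
    (fun i hi G hG hGi => by
      refine (hpack G hG (fun j => luxNorm Ψ (Q j) (fun x => σ x ^ (1 / p)) ^ p)
        (fun x => orliczMaximal Ψ ((Q i).set.indicator fun y => σ y ^ (1 / p)) x ^ p)
        (Q i).set hGi fun j hj x hx => ?_).trans ?_
      · exact ENNReal.rpow_le_rpow (luxNorm_le_orliczMaximal_indicator Ψ (hGi j hj) _ hx) hp0.le
      · rw [mul_assoc]
        gcongr
        exact lintegral_orliczMaximal_le hσ Ψ (hσ0 i (hSP hi)))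
  calc ∫⁻ z, (⨆ i ∈ F, (Q i).tent.indicator (fun _ => average g (Q i)) z) ^ p ∂μ
      ≤ ∫⁻ z, ∑ s ∈ S, (Q s).tent.indicator (fun _ => (2 * average g (Q s)) ^ p) z ∂μ :=
        lintegral_mono hpt
    _ = ∑ s ∈ S, (2 * average g (Q s)) ^ p * μ (Q s).tent := by
        rw [lintegral_finsetSum _ fun s _ => measurable_const.indicator (Q s).measurableSet_tent]
        refine Finset.sum_congr rfl fun s _ => ?_
        rw [lintegral_indicator (Q s).measurableSet_tent, setLIntegral_const]
    _ ≤ ∑ s ∈ S, 8 ^ p * bumpConst p μ σ Φ * (c s * ENNReal.ofReal (a s ^ p)) := by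
        refine Finset.sum_le_sum fun s hs => ?_
        rw [← ENNReal.ofReal_rpow_of_nonneg ENNReal.toReal_nonneg hp0.le]
        exact rpow_average_mul_tent_le hp hσ hΦ hΨ (hLa s (hSP hs))
    _ ≤ 8 ^ p * bumpConst p μ σ Φ * (ENNReal.ofReal (embeddingConst p) *
          (4 * wilsonConst p σ Ψ) * ∫⁻ x, ‖f x‖ₑ ^ p ∂weightMeasure σ) := by
        rw [← Finset.mul_sum]; gcongr
    _ = _ := by
        have he : 0 ≤ embeddingConst p := by
          have : 0 < p - 1 := by linarith
          unfold embeddingConst; positivity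
        rw [dyadicConst, ENNReal.ofReal_mul (by positivity), ENNReal.ofReal_mul (by positivity),
          ← ENNReal.ofReal_rpow_of_nonneg (by norm_num) hp0.le, ENNReal.ofReal_ofNat,
          ENNReal.ofReal_ofNat]
        ring

/-! ### Adjacent dyadic grids -/

/-- The offset of the shifted dyadic grid at scale `2 ^ k`, in units of `2 ^ k`. -/
def gridOffset (b : Bool) (k : ℤ) : ℝ := if b then (if Even k then 1 / 3 else -1 / 3) else 0

/-- The cubes of the adjacent dyadic grid with shift pattern `b`, indexed by scale and position. -/
def gridCube {n : ℕ} (b : Fin n → Bool) (q : ℤ × (Fin n → ℤ)) : Cube n where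
  corner i := 2 ^ q.1 * (q.2 i + gridOffset (b i) q.1)
  side := 2 ^ q.1
  side_pos := by positivity

/-- Endpoints at scale `k + 1` are also endpoints at scale `k`. The alternating sign is needed: `2 *
(∓1/3)` differs from `±1/3` by an integer, whereas `2/3 - 1/3` is not one. -/
theorem gridOffset_succ (b : Bool) (k : ℤ) :
    ∃ d : ℤ, 2 * gridOffset b (k + 1) = gridOffset b k + d := by
  cases b
  · exact ⟨0, by simp [gridOffset]⟩
  · by_cases hk : Even k
    · have hk' : ¬ Even (k + 1) := by simpa [Int.even_add_one] using hk
      exact ⟨-1, by simp only [gridOffset, hk, hk', if_true, if_false]; norm_num⟩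
    · have hk' : Even (k + 1) := by simpa [Int.even_add_one] using hk
      exact ⟨1, by simp only [gridOffset, hk, hk', if_true, if_false]; norm_num⟩

theorem gridOffset_add (b : Bool) (k : ℤ) (j : ℕ) :
    ∃ d : ℤ, 2 ^ j * gridOffset b (k + j) = gridOffset b k + d := by
  induction j with
  | zero => exact ⟨0, by simp⟩
  | succ j ih =>
    obtain ⟨d, hd⟩ := ih
    obtain ⟨e, he⟩ := gridOffset_succ b (k + j)
    refine ⟨d + 2 ^ j * e, ?_⟩
    push_cast
    rw [← add_assoc, pow_succ, mul_assoc, he, mul_add, hd]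
    ring

/-- Two intervals of a shifted dyadic grid are nested or disjoint. -/
theorem grid_interval (b : Bool) {k k' : ℤ} (hk : k ≤ k') (m m' : ℤ) :
    Disjoint (Set.Ico ((2 : ℝ) ^ k * (m + gridOffset b k)) (2 ^ k * (m + gridOffset b k) + 2 ^ k))
      (Set.Ico ((2 : ℝ) ^ k' * (m' + gridOffset b k')) (2 ^ k' * (m' + gridOffset b k') + 2 ^ k')) ∨
    Set.Ico ((2 : ℝ) ^ k * (m + gridOffset b k)) (2 ^ k * (m + gridOffset b k) + 2 ^ k) ⊆
      Set.Ico ((2 : ℝ) ^ k' * (m' + gridOffset b k'))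
        (2 ^ k' * (m' + gridOffset b k') + 2 ^ k') := by
  obtain ⟨j, rfl⟩ := Int.le.dest hk
  obtain ⟨d, hd⟩ := gridOffset_add b k j
  have hpow : (2 : ℝ) ^ (k + (j : ℤ)) = 2 ^ k * 2 ^ j := by
    rw [zpow_add₀ (by norm_num), zpow_natCast]
  have h0 : (0 : ℝ) < 2 ^ k := by positivity
  -- In units of `2 ^ k` and relative to the offset at scale `k`, all endpoints are integers; the
  -- small interval has length 1, so it cannot straddle an endpoint of the large one.
  have hlo : (2 : ℝ) ^ (k + (j : ℤ)) * (m' + gridOffset b (k + j)) =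
      2 ^ k * (((2 ^ j * m' + d : ℤ) : ℝ) + gridOffset b k) := by
    rw [hpow, mul_assoc, mul_add, hd]; push_cast; ring
  have hhi : (2 : ℝ) ^ (k + (j : ℤ)) * (m' + gridOffset b (k + j)) + 2 ^ (k + (j : ℤ)) =
      2 ^ k * (((2 ^ j * m' + d + 2 ^ j : ℤ) : ℝ) + gridOffset b k) := by
    rw [hlo, hpow]; push_cast; ring
  have hhi' : (2 : ℝ) ^ k * (m + gridOffset b k) + 2 ^ k =
      2 ^ k * (((m + 1 : ℤ) : ℝ) + gridOffset b k) := by push_cast; ring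
  rw [hhi, hlo, hhi']
  generalize 2 ^ j * m' + d = M
  generalize (2 ^ j : ℤ) = L
  have hmono : ∀ x y : ℤ, x ≤ y →
      (2 : ℝ) ^ k * (x + gridOffset b k) ≤ 2 ^ k * (y + gridOffset b k) := fun x y hxy => by
    gcongr
  by_cases h1 : m + 1 ≤ M
  · exact Or.inl (Set.disjoint_left.2 fun x hx hx' =>
      absurd (hx.2.trans_le ((hmono _ _ h1).trans hx'.1)) (lt_irrefl _))
  by_cases h2 : M + L ≤ m
  · exact Or.inl (Set.disjoint_left.2 fun x hx hx' =>
      absurd (hx'.2.trans_le ((hmono _ _ h2).trans hx.1)) (lt_irrefl _))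
  · exact Or.inr (Set.Ico_subset_Ico (hmono _ _ (by omega)) (hmono _ _ (by omega)))

theorem gridCube_set {n : ℕ} (b : Fin n → Bool) (q : ℤ × (Fin n → ℤ)) :
    (gridCube b q).set = Set.univ.pi fun i =>
      Set.Ico ((2 : ℝ) ^ q.1 * (q.2 i + gridOffset (b i) q.1))
        (2 ^ q.1 * (q.2 i + gridOffset (b i) q.1) + 2 ^ q.1) := by
  simp [Cube.set, gridCube]

theorem gridCube_nested {n : ℕ} (b : Fin n → Bool) {q q' : ℤ × (Fin n → ℤ)} (h : q.1 ≤ q'.1) :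
    Disjoint (gridCube b q).set (gridCube b q').set ∨
      (gridCube b q).set ⊆ (gridCube b q').set := by
  rw [gridCube_set, gridCube_set]
  by_cases hd : ∃ i, Disjoint
      (Set.Ico ((2 : ℝ) ^ q.1 * (q.2 i + gridOffset (b i) q.1))
        (2 ^ q.1 * (q.2 i + gridOffset (b i) q.1) + 2 ^ q.1))
      (Set.Ico ((2 : ℝ) ^ q'.1 * (q'.2 i + gridOffset (b i) q'.1))
        (2 ^ q'.1 * (q'.2 i + gridOffset (b i) q'.1) + 2 ^ q'.1))
  · obtain ⟨i, hi⟩ := hd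
    exact Or.inl (Set.disjoint_left.2 fun x hx hx' =>
      Set.disjoint_left.1 hi (hx i trivial) (hx' i trivial))
  · push Not at hd
    exact Or.inr (Set.pi_mono fun i _ =>
      (grid_interval (b i) h (q.2 i) (q'.2 i)).resolve_left (hd i))

theorem gridCube_disjoint {n : ℕ} (b : Fin n → Bool) {q q' : ℤ × (Fin n → ℤ)} (h : q.1 = q'.1)
    (hne : q ≠ q') : Disjoint (gridCube b q).set (gridCube b q').set := by
  obtain ⟨k, m⟩ := q
  obtain ⟨k', m'⟩ := q'
  obtain rfl : k = k' := h
  have hm : m ≠ m' := fun h => hne (by rw [h])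
  obtain ⟨i, hi⟩ := Function.ne_iff.1 hm
  rw [gridCube_set, gridCube_set]
  refine Set.disjoint_left.2 fun x hx hx' => hi ?_
  have h1 := hx i trivial
  have h2 := hx' i trivial
  simp only [Set.mem_Ico] at h1 h2
  have h0 : (0 : ℝ) < 2 ^ k := by positivity
  have h3 : ((m i : ℤ) : ℝ) < m' i + 1 := by
    have := h1.1.trans_lt h2.2
    rw [← mul_add_one] at this
    have := lt_of_mul_lt_mul_left this h0.le
    linarith
  have h4 : ((m' i : ℤ) : ℝ) < m i + 1 := by
    have := h2.1.trans_lt h1.2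
    rw [← mul_add_one] at this
    have := lt_of_mul_lt_mul_left this h0.le
    linarith
  have h5 : m i < m' i + 1 := by exact_mod_cast h3
  have h6 : m' i < m i + 1 := by exact_mod_cast h4
  omega

theorem gridCube_side_lt {n : ℕ} (b : Fin n → Bool) {q q' : ℤ × (Fin n → ℤ)} (h : q.1 < q'.1) :
    (gridCube b q).side < (gridCube b q').side :=
  zpow_lt_zpow_right₀ (by norm_num : (1 : ℝ≥0) < 2) h

theorem gridCube_laminar {n : ℕ} (b : Fin n → Bool) (F : Finset (ℤ × (Fin n → ℤ))) :
    Laminar F (fun q => (gridCube b q).set) fun q => (gridCube b q).side := by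
  intro q _ q' _ hne
  rcases lt_trichotomy q.1 q'.1 with h | h | h
  · rcases gridCube_nested b h.le with hd | hs
    · exact Or.inl hd
    · exact Or.inr (Or.inl ⟨hs, gridCube_side_lt b h⟩)
  · exact Or.inl (gridCube_disjoint b h hne)
  · rcases gridCube_nested b h.le with hd | hs
    · exact Or.inl hd.symm
    · exact Or.inr (Or.inr ⟨hs, gridCube_side_lt b h⟩)

/-- The one-third trick on the line. -/
theorem exists_grid_interval (k : ℤ) {a l : ℝ} (hl : 3 * l ≤ 2 ^ k) :
    ∃ (b : Bool) (m : ℤ), 2 ^ k * (m + gridOffset b k) ≤ a ∧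
      a + l ≤ 2 ^ k * (m + gridOffset b k) + 2 ^ k := by
  have h0 : (0 : ℝ) < 2 ^ k := by positivity
  obtain ⟨u, rfl⟩ : ∃ u, a = 2 ^ k * u := ⟨a / 2 ^ k, by field_simp⟩
  have key : ∀ (b : Bool) (m : ℤ), m + gridOffset b k ≤ u → u + 1 / 3 ≤ m + gridOffset b k + 1 →
      ∃ (b : Bool) (m : ℤ), 2 ^ k * (m + gridOffset b k) ≤ 2 ^ k * u ∧
        2 ^ k * u + l ≤ 2 ^ k * (m + gridOffset b k) + 2 ^ k := fun b m h1 h2 => by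
    refine ⟨b, m, by gcongr, ?_⟩
    have := mul_le_mul_of_nonneg_left h2 h0.le
    linarith
  have hf1 := Int.floor_le u
  have hf2 := Int.lt_floor_add_one u
  -- The unshifted interval fails only if the fractional part of `u` exceeds `2/3`; the shifted
  -- interval starting at `⌊u⌋ + 1/3` or `⌊u⌋ + 2/3` then works.
  by_cases hu : u + 1 / 3 ≤ ⌊u⌋ + 1
  · exact key false ⌊u⌋ (by simpa [gridOffset] using hf1) (by simpa [gridOffset] using hu)
  · by_cases hk : Even k
    · refine key true ⌊u⌋ ?_ ?_ <;> simp only [gridOffset, hk, if_true] <;> linarith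
    · refine key true (⌊u⌋ + 1) ?_ ?_ <;> simp only [gridOffset, hk, if_true, if_false] <;>
        push_cast <;> linarith

/-- Every cube is contained in a cube of comparable size of one of the adjacent dyadic grids. -/
theorem exists_gridCube {n : ℕ} (Q : Cube n) :
    ∃ (b : Fin n → Bool) (q : ℤ × (Fin n → ℤ)), Q.set ⊆ (gridCube b q).set ∧
      Q.side < (gridCube b q).side ∧ (gridCube b q).side ≤ 6 * Q.side := by
  have hpos : (0 : ℝ) < Q.side := by exact_mod_cast Q.side_pos
  -- The grid cube has side `2 ^ (j + 1)`, which lies in `(3ℓ, 6ℓ]`. The scale is common to all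
  -- coordinates, while the shift is chosen in each one separately.
  obtain ⟨j, hj1, hj2⟩ := exists_mem_Ico_zpow (x := 3 * (Q.side : ℝ)) (y := 2) (by positivity) (by norm_num)
  choose b m h1 h2 using fun i => exists_grid_interval (j + 1) (a := Q.corner i) hj2.le
  refine ⟨b, (j + 1, m), ?_, ?_, ?_⟩
  · rw [gridCube_set]
    exact Set.pi_mono fun i _ => Set.Ico_subset_Ico (h1 i) (h2 i)
  · rw [← NNReal.coe_lt_coe]
    simp only [gridCube, NNReal.coe_zpow, NNReal.coe_ofNat]
    linarith
  · rw [← NNReal.coe_le_coe]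
    simp only [gridCube, NNReal.coe_zpow, NNReal.coe_ofNat, NNReal.coe_mul]
    rw [zpow_add_one₀ (by norm_num)]
    linarith

/-! ### From dyadic maximal operators to the full one -/

/-- The maximal operator of one of the adjacent dyadic grids. -/
def dyadicMaximal {n : ℕ} (b : Fin n → Bool) (g : (Fin n → ℝ) → ℝ) (z : HalfSpace n) : ℝ≥0∞ :=
  ⨆ q, (gridCube b q).tent.indicator (fun _ => average g (gridCube b q)) z

theorem measurable_dyadicMaximal {n : ℕ} (b : Fin n → Bool) (g : (Fin n → ℝ) → ℝ) :
    Measurable (dyadicMaximal b g) :=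
  Measurable.iSup fun q => measurable_const.indicator (gridCube b q).measurableSet_tent

theorem average_le_of_subset {n : ℕ} (g : (Fin n → ℝ) → ℝ) {Q R : Cube n} (h : Q.set ⊆ R.set)
    (hs : R.side ≤ 6 * Q.side) : average g Q ≤ 6 ^ n * average g R := by
  have hv : volume R.set ≤ 6 ^ n * volume Q.set := by
    rw [Q.volume_eq, R.volume_eq, ← mul_pow]
    gcongr
    exact_mod_cast hs
  rw [average, ENNReal.div_le_iff Q.volume_ne_zero Q.volume_ne_top]
  calc ∫⁻ y in Q.set, ‖g y‖ₑ ≤ ∫⁻ y in R.set, ‖g y‖ₑ := lintegral_mono_set h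
    _ = average g R * volume R.set := by
        rw [average, ENNReal.div_mul_cancel R.volume_ne_zero R.volume_ne_top]
    _ ≤ average g R * (6 ^ n * volume Q.set) := by gcongr
    _ = _ := by ring

theorem maximal_rpow_le {n : ℕ} (g : (Fin n → ℝ) → ℝ) {p : ℝ} (hp : 0 < p) (z : HalfSpace n) :
    maximal g z ^ p ≤ (6 ^ n) ^ p * ∑ b : Fin n → Bool, dyadicMaximal b g z ^ p := by
  rw [← ENNReal.le_rpow_inv_iff hp]
  refine iSup_le fun Q => iSup₂_le fun hx ht => ?_
  rw [ENNReal.le_rpow_inv_iff hp]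
  obtain ⟨b, q, hsub, hlt, hle⟩ := exists_gridCube Q
  -- The strictly larger side turns `t ≤ ℓ(Q)` into the strict inequality that defines the tent.
  have hz : z ∈ (gridCube b q).tent := ⟨hsub hx, ht.trans_lt hlt⟩
  have h1 : average g (gridCube b q) ≤ dyadicMaximal b g z := by
    refine le_trans (le_of_eq ?_) (le_iSup _ q)
    rw [Set.indicator_of_mem hz]
  calc average g Q ^ p ≤ (6 ^ n * dyadicMaximal b g z) ^ p := by
        gcongr
        exact (average_le_of_subset g hsub hle).trans (by gcongr)
    _ = (6 ^ n) ^ p * dyadicMaximal b g z ^ p := ENNReal.mul_rpow_of_nonneg _ _ hp.le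
    _ ≤ _ := by
        gcongr
        exact Finset.single_le_sum (f := fun b => dyadicMaximal b g z ^ p)
          (fun _ _ => zero_le) (Finset.mem_univ b)

/-- The bound for finite laminar families does not depend on the family, so it passes to the
supremum by monotone convergence along finite sets of grid cubes. -/
theorem lintegral_dyadicMaximal_le {n : ℕ} {p : ℝ} (hp : 1 < p)
    {μ : Measure (HalfSpace n)} {σ : (Fin n → ℝ) → ℝ} {Φ : ℝ≥0 → ℝ≥0} {Ψ : ℝ≥0 → ℝ≥0∞}
    (hσ : IsWeight σ) (hΦ : IsYoung Φ) (hΨ : IsComplementary Φ Ψ) {f : (Fin n → ℝ) → ℝ}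
    (hf : MemLp f (ENNReal.ofReal p) (weightMeasure σ)) (b : Fin n → Bool) :
    ∫⁻ z, dyadicMaximal b (fun x => f x * σ x) z ^ p ∂μ ≤
      ENNReal.ofReal (dyadicConst p) * (bumpConst p μ σ Φ * wilsonConst p σ Ψ) *
        ∫⁻ x, ‖f x‖ₑ ^ p ∂weightMeasure σ := by
  have hp0 : 0 < p := by linarith
  set g := fun x => f x * σ x
  have h1 : ∀ z, dyadicMaximal b g z ^ p = ⨆ F : Finset (ℤ × (Fin n → ℤ)),
      (⨆ q ∈ F, (gridCube b q).tent.indicator (fun _ => average g (gridCube b q)) z) ^ p := by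
    intro z
    rw [dyadicMaximal, iSup_eq_iSup_finset]
    exact (ENNReal.orderIsoRpow p hp0).map_iSup _
  simp_rw [h1]
  rw [lintegral_iSup_directed]
  · exact iSup_le fun F => (gridCube_laminar b F).lintegral_maximal_le hp hσ hΦ hΨ hf
  · intro F
    refine (Measurable.pow_const ?_ p).aemeasurable
    exact Measurable.biSup _ F.countable_toSet fun q _ =>
      measurable_const.indicator (gridCube b q).measurableSet_tent
  · classical
    refine directed_of_isDirected_le fun F G hFG z => ?_
    exact ENNReal.rpow_le_rpow (biSup_mono hFG) hp0.le

/-- The two-weight inequality for the maximal operator in integral form. -/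
theorem lintegral_maximal_rpow_le {n : ℕ} {p : ℝ} (hp : 1 < p)
    {μ : Measure (HalfSpace n)} {σ : (Fin n → ℝ) → ℝ} {Φ : ℝ≥0 → ℝ≥0} {Ψ : ℝ≥0 → ℝ≥0∞}
    (hσ : IsWeight σ) (hΦ : IsYoung Φ) (hΨ : IsComplementary Φ Ψ) {f : (Fin n → ℝ) → ℝ}
    (hf : MemLp f (ENNReal.ofReal p) (weightMeasure σ)) :
    ∫⁻ z, maximal (fun x => f x * σ x) z ^ p ∂μ ≤
      ENNReal.ofReal ((6 ^ n) ^ p * 2 ^ n * dyadicConst p) *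
        (bumpConst p μ σ Φ * wilsonConst p σ Ψ) * ∫⁻ x, ‖f x‖ₑ ^ p ∂weightMeasure σ := by
  have hp0 : 0 < p := by linarith
  calc ∫⁻ z, maximal (fun x => f x * σ x) z ^ p ∂μ
      ≤ ∫⁻ z, (6 ^ n) ^ p * ∑ b : Fin n → Bool, dyadicMaximal b (fun x => f x * σ x) z ^ p ∂μ :=
        lintegral_mono fun z => maximal_rpow_le _ hp0 z
    _ = (6 ^ n) ^ p * ∑ b : Fin n → Bool,
          ∫⁻ z, dyadicMaximal b (fun x => f x * σ x) z ^ p ∂μ := by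
        rw [lintegral_const_mul' _ _ (ENNReal.rpow_ne_top_of_nonneg hp0.le (by finiteness)),
          lintegral_finsetSum _ fun b _ => (measurable_dyadicMaximal b _).pow_const p]
    _ ≤ (6 ^ n) ^ p * ∑ _b : Fin n → Bool, ENNReal.ofReal (dyadicConst p) *
          (bumpConst p μ σ Φ * wilsonConst p σ Ψ) * ∫⁻ x, ‖f x‖ₑ ^ p ∂weightMeasure σ := by
        gcongr with b
        exact lintegral_dyadicMaximal_le hp hσ hΦ hΨ hf b
    _ = _ := by
        rw [Finset.sum_const, Finset.card_univ, Fintype.card_fun, Fintype.card_bool,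
          Fintype.card_fin, ENNReal.ofReal_mul (by positivity), ENNReal.ofReal_mul (by positivity),
          ← ENNReal.ofReal_rpow_of_nonneg (by positivity) hp0.le, ENNReal.ofReal_pow (by norm_num),
          ENNReal.ofReal_pow (by norm_num), ENNReal.ofReal_ofNat, ENNReal.ofReal_ofNat,
          nsmul_eq_mul]
        push_cast
        ring

end Carleson

end

/-- Two-weight bump condition for the maximal operator on the upper half-space, with a constant
that depends only on `n` and `p`. -/
theorem theorem2p3 (n : ℕ) (hn : 0 < n) (p : ℝ) (hp : 1 < p) :
    ∃ C : ℝ≥0, ∀ (μ : Measure (Carleson.HalfSpace n)) (σ : (Fin n → ℝ) → ℝ)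
      (Φ : ℝ≥0 → ℝ≥0) (Ψ : ℝ≥0 → ℝ≥0∞),
      Carleson.IsWeight σ → Carleson.IsYoung Φ → Carleson.IsComplementary Φ Ψ →
        Carleson.maximalNorm p μ σ ≤
          C * (Carleson.bumpConst p μ σ Φ * Carleson.wilsonConst p σ Ψ) ^ (1 / p) := by
  have hp0 : 0 < p := by linarith
  have hpi : 0 ≤ 1 / p := by positivity
  refine ⟨((6 ^ n) ^ p * 2 ^ n * Carleson.dyadicConst p).toNNReal ^ (1 / p),
    fun μ σ Φ Ψ hσ hΦ hΨ => sInf_le fun f hf => ?_⟩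
  have h0 : ENNReal.ofReal p ≠ 0 := by simpa using hp0
  rw [eLpNorm_eq_lintegral_rpow_enorm_toReal h0 ENNReal.ofReal_ne_top,
    eLpNorm_eq_lintegral_rpow_enorm_toReal h0 ENNReal.ofReal_ne_top, ENNReal.toReal_ofReal hp0.le,
    ENNReal.coe_rpow_of_nonneg _ hpi, ← ENNReal.mul_rpow_of_nonneg _ _ hpi,
    ← ENNReal.mul_rpow_of_nonneg _ _ hpi]
  refine ENNReal.rpow_le_rpow ?_ hpi
  simp only [enorm_eq_self]
  exact Carleson.lintegral_maximal_rpow_le hp hσ hΦ hΨ hf
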